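/- Let $k$ be a field, let $r$ and $c$ be integers with $2\le r\le c$, let $X$ be an $r\times c$ matrix of indeterminates, and let $I_2(X)$ be the ideal of the polynomial ring $k[X]$ generated by the $2\times 2$ minors of $X$. Give $R=k[X]/I_2(X)$ the standard grading, let $d$ be the Krull dimension of $R$, let $\ell_1,\dots,\ell_d$ be a regular sequence of linear forms in $R$, and let $S=R/(\ell_1,\dots,\ell_d)$ be the corresponding Artinian reduction of $R$, with the induced grading $S=\bigoplus_{i\ge 0}[S]_i$. Suppose that at least one of the following conditions holds: 1. $r=c$ and this common number is odd; 2. $r<c\le r+3$; 3. $c-1$ does not divide $(r-1)!$. Then $S$ has no homogeneous exact zero divisors. That is, there are no nonzero elements $a,b\in S$ with $a$ homogeneous, $(0:_S a)=(b)$ and $(0:_S b)=(a)$. Moreover, the Hilbert series $\operatorname{HS}_S(t)=\sum_{i}\dim_k[S]_i\,t^i$ is a polynomial, and $$\operatorname{HS}_S(-1)=\sum_{i=0}^{r-1}(-1)^i\binom{r-1}{i}\binom{c-1}{i}\neq 0 .$$ -/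

import Mathlib

open scoped Nat

/-- The ideal `I_t(M)` generated by the `t × t` minors of the matrix `M`. -/
def minorsIdeal {A : Type*} [CommRing A] {r c : ℕ} (t : ℕ) (M : Matrix (Fin r) (Fin c) A) :
    Ideal A :=
  Ideal.span {d | ∃ (f : Fin t ↪o Fin r) (g : Fin t ↪o Fin c), d = (M.submatrix f g).det}

/-- The grading induced on `A ⧸ I` by a family of homogeneous components of `A`
(a genuine grading when `I` is a homogeneous ideal). -/
noncomputable def quotientGrading {k A : Type*} [CommRing k] [CommRing A] [Algebra k A]
    (𝒜 : ℕ → Submodule k A) (I : Ideal A) : ℕ → Submodule k (A ⧸ I) :=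
  fun n => (𝒜 n).map (Ideal.Quotient.mkₐ k I).toLinearMap

/-- The determinantal ring `k[X] / I_t(X)`, where `X` is an `r × c` matrix of indeterminates. -/
abbrev DeterminantalRing (k : Type*) [Field k] (r c t : ℕ) : Type _ :=
  MvPolynomial (Fin r × Fin c) k ⧸
    minorsIdeal t (Matrix.mvPolynomialX (Fin r) (Fin c) k)

/-- The standard grading of `k[X] / I_t(X)`. -/
noncomputable def DeterminantalRing.grading (k : Type*) [Field k] (r c t : ℕ) :
    ℕ → Submodule k (DeterminantalRing k r c t) :=
  quotientGrading (MvPolynomial.homogeneousSubmodule (Fin r × Fin c) k) _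

/-- `ℓ` is a regular sequence of linear forms in the graded ring `R`, of length `dim R`; that is,
`R ⧸ (ℓ)` is an Artinian reduction of `R`. -/
structure IsArtinianReductionSeq {k R : Type*} [Field k] [CommRing R] [Algebra k R]
    (𝓡 : ℕ → Submodule k R) (ℓ : List R) : Prop where
  linear : ∀ x ∈ ℓ, x ∈ 𝓡 1
  regular : RingTheory.Sequence.IsRegular R ℓ
  length_eq : ringKrullDim R = (ℓ.length : WithBot ℕ∞)

/-- `(a, b)` is an exact pair of zero divisors: `a` and `b` are nonzero, `(0 : a) = (b)` and
`(0 : b) = (a)`. Non-vanishing only removes the degenerate pairs (unit, `0`) and (`0`, unit). -/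
structure IsExactPair {S : Type*} [CommRing S] (a b : S) : Prop where
  left_ne_zero : a ≠ 0
  right_ne_zero : b ≠ 0
  colon_left : (⊥ : Ideal S).colon {a} = Ideal.span {b}
  colon_right : (⊥ : Ideal S).colon {b} = Ideal.span {a}

/-- `a` is an exact zero divisor if it belongs to an exact pair of zero divisors. -/
def IsExactZeroDivisor {S : Type*} [CommRing S] (a : S) : Prop :=
  ∃ b : S, IsExactPair a b

/-- The Hilbert series `∑ (dim_k [S]_i) t^i`, for finite-dimensional components `[S]_i`. -/
noncomputable def hilbertSeries {k S : Type*} [Field k] [AddCommGroup S] [Module k S]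
    (𝒮 : ℕ → Submodule k S) : PowerSeries ℤ :=
  PowerSeries.mk fun i => (Module.finrank k (𝒮 i) : ℤ)

/-! ### Alternating sums of products of binomial coefficients: nonvanishing at -1. -/

section NarayanaType

open Polynomial

/-! Write m = r - 1 and n = c - 1. The ring R is the Segre product of polynomial rings in r and c
variables, so its Hilbert series is ∑ C(k+m,m) C(k+n,n) t^k = H(t) / (1-t)^(m+n+1) with H = ∑ C(m,i)
C(n,i) t^i. Each regular linear form contributes a factor 1 - t, and d = m+n+1, so H is the Hilbert
series of S.

Let a be a homogeneous exact zero divisor of degree p. Its partner b can be chosen homogeneous, of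
degree q say, and p, q > 0. Rank-nullity for multiplication by a and by b gives H = P + t^q Q and H
= Q + t^p P, hence H (1 - t^q) = P (1 - t^(p+q)). Therefore H vanishes at every primitive (p+q)-th
root of unity, where p+q ≥ 2 (`exists_eval₂_primitiveRoot_eq_zero_of_isExactZeroDivisor`).

On the other hand H has only real roots: a Rodrigues-type formula expresses it through the m-th
derivative of x^m (x+1)^n, and Gauss–Lucas applies (`im_eq_zero_of_eval₂_chooseMulChoosePoly`). The
only real root of unity of order at least 2 is -1, so it remains to see H(-1) ≠ 0, and this is where
the three numerical conditions enter (`sum_alternating_choose_ne_zero`). -/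

/-- The polynomial `∑ᵢ (m choose i) (n choose i) Xⁱ`. -/
noncomputable def chooseMulChoosePoly (m n : ℕ) : ℤ[X] :=
  ∑ i ∈ Finset.range (m + 1), C ((m.choose i : ℤ) * (n.choose i : ℤ)) * X ^ i

theorem coeff_chooseMulChoosePoly (m n i : ℕ) :
    (chooseMulChoosePoly m n).coeff i = (m.choose i : ℤ) * (n.choose i : ℤ) := by
  simp only [chooseMulChoosePoly, finsetSum_coeff, coeff_C_mul, coeff_X_pow, mul_ite, mul_one,
    mul_zero, Finset.sum_ite_eq, Finset.mem_range]
  split_ifs with h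
  · rfl
  · rw [Nat.choose_eq_zero_of_lt (by omega : m < i)]; simp

theorem coeff_one_sub_X_pow_int (n i : ℕ) :
    ((1 - X : ℤ[X]) ^ n).coeff i = (-1) ^ i * (n.choose i : ℤ) := by
  have h : (1 - X : ℤ[X]) ^ n = ((1 + X) ^ n : ℤ[X]).comp (C (-1) * X) := by
    simp [sub_eq_add_neg]
  rw [h, comp_C_mul_X_coeff, coeff_one_add_X_pow, mul_comm]

theorem eval_neg_one_chooseMulChoosePoly (m n : ℕ) :
    (chooseMulChoosePoly m n).eval (-1) =
      ∑ i ∈ Finset.range (m + 1), (-1) ^ i * (m.choose i : ℤ) * (n.choose i : ℤ) := by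
  simp only [chooseMulChoosePoly, eval_finsetSum, eval_mul, eval_C, eval_pow, eval_X]
  exact Finset.sum_congr rfl fun i _ => by ring

theorem sum_alternating_choose_eq_coeff (m n : ℕ) :
    ∑ i ∈ Finset.range (m + 1), (-1) ^ i * (m.choose i : ℤ) * (n.choose i : ℤ) =
      ((1 - X : ℤ[X]) ^ n * (1 + X) ^ m).coeff m := by
  rw [coeff_mul, Finset.Nat.sum_antidiagonal_eq_sum_range_succ_mk]
  refine Finset.sum_congr rfl fun i hi => ?_
  rw [coeff_one_sub_X_pow_int, coeff_one_add_X_pow,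
    Nat.choose_symm (Nat.lt_succ_iff.mp (Finset.mem_range.mp hi))]
  ring

theorem coeff_one_sub_X_sq_pow (m k : ℕ) :
    ((1 - X ^ 2 : ℤ[X]) ^ m).coeff k =
      if 2 ∣ k then (-1) ^ (k / 2) * (m.choose (k / 2) : ℤ) else 0 := by
  have h : (1 - X ^ 2 : ℤ[X]) ^ m = expand ℤ 2 ((1 - X) ^ m) := by simp
  rw [h, coeff_expand (by norm_num)]
  simp only [coeff_one_sub_X_pow_int]

/-- Pairing m of the factors 1 - x with the factors 1 + x leaves only (1-x)^e. For e = c - r ≤ 3 the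
coefficient is a sum of at most four terms, and parity kills those with an odd index in (1-x²)^m. -/
theorem sum_alternating_choose_add (m e : ℕ) :
    ∑ i ∈ Finset.range (m + 1), (-1) ^ i * (m.choose i : ℤ) * ((m + e).choose i : ℤ) =
      ((1 - X ^ 2 : ℤ[X]) ^ m * (1 - X) ^ e).coeff m := by
  rw [sum_alternating_choose_eq_coeff]
  congr 1
  rw [show (1 - X ^ 2 : ℤ[X]) = (1 - X) * (1 + X) by ring, mul_pow, pow_add]
  ring

theorem sum_alternating_choose_self_ne_zero (m : ℕ) (hm : Even m) :
    ∑ i ∈ Finset.range (m + 1), (-1) ^ i * (m.choose i : ℤ) * (m.choose i : ℤ) ≠ 0 := by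
  have h := sum_alternating_choose_add m 0
  simp only [Nat.add_zero] at h
  rw [h, pow_zero, mul_one, coeff_one_sub_X_sq_pow, if_pos hm.two_dvd]
  have : m.choose (m / 2) ≠ 0 := (Nat.choose_pos (Nat.div_le_self _ _)).ne'
  simp [this]

theorem sum_alternating_choose_add_one_ne_zero (m : ℕ) :
    ∑ i ∈ Finset.range (m + 1), (-1) ^ i * (m.choose i : ℤ) * ((m + 1).choose i : ℤ) ≠ 0 := by
  rw [sum_alternating_choose_add, pow_one, mul_sub, mul_one, coeff_sub]
  rcases m with _ | m
  · simp
  rw [coeff_mul_X, coeff_one_sub_X_sq_pow, coeff_one_sub_X_sq_pow]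
  have h1 : (m + 1).choose ((m + 1) / 2) ≠ 0 := (Nat.choose_pos (Nat.div_le_self _ _)).ne'
  have h2 : (m + 1).choose (m / 2) ≠ 0 := (Nat.choose_pos (by omega)).ne'
  rcases Nat.even_or_odd' m with ⟨s, rfl | rfl⟩
  · rw [if_neg (by omega), if_pos (by omega)]; simpa using h2
  · rw [if_pos (by omega), if_neg (by omega)]; simpa using h1

theorem sum_alternating_choose_add_two_ne_zero (m : ℕ) :
    ∑ i ∈ Finset.range (m + 1), (-1) ^ i * (m.choose i : ℤ) * ((m + 2).choose i : ℤ) ≠ 0 := by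
  rw [sum_alternating_choose_add,
    show (1 - X ^ 2 : ℤ[X]) ^ m * (1 - X) ^ 2 = (1 - X ^ 2 : ℤ[X]) ^ m
      - C 2 * ((1 - X ^ 2 : ℤ[X]) ^ m * X ^ 1) + (1 - X ^ 2 : ℤ[X]) ^ m * X ^ 2 by
      simp only [map_ofNat]; ring]
  simp only [coeff_add, coeff_sub, coeff_C_mul, coeff_mul_X_pow', coeff_one_sub_X_sq_pow]
  rcases Nat.even_or_odd' m with ⟨s, rfl | rfl⟩
  · rcases s with _ | t
    · simp
    rw [if_pos (by omega), if_pos (by omega), if_neg (by omega), if_pos (by omega),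
      if_pos (by omega), show 2 * (t + 1) / 2 = t + 1 by omega,
      show (2 * (t + 1) - 2) / 2 = t by omega]
    -- For m = 2(t+1) the surviving terms are ±(C(m,t) - C(m,t+1)); the ratio of these binomials is
    -- (t+2)/(t+1), never 1.
    have h := Nat.choose_succ_right_eq (2 * (t + 1)) t
    have hp : 0 < (2 * (t + 1)).choose t := Nat.choose_pos (by omega)
    rw [show 2 * (t + 1) - t = t + 2 by omega] at h
    intro h0
    have h1 : (-1 : ℤ) ^ t *
        (((2 * (t + 1)).choose t : ℤ) - ((2 * (t + 1)).choose (t + 1) : ℤ)) = 0 := by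
      rw [pow_succ] at h0; linear_combination h0
    rcases mul_eq_zero.mp h1 with h1 | h1
    · simp at h1
    · have h2 : (2 * (t + 1)).choose (t + 1) = (2 * (t + 1)).choose t := by omega
      rw [h2] at h
      have := Nat.eq_of_mul_eq_mul_left hp h
      omega
  · have h1 : (2 * s + 1).choose s ≠ 0 := (Nat.choose_pos (by omega)).ne'
    -- The outer guard fails for s = 0 and parity fails for s > 0, so this term vanishes either way.
    have e1 : (if 2 ≤ 2 * s + 1 then if 2 ∣ 2 * s + 1 - 2 then
        (-1 : ℤ) ^ ((2 * s + 1 - 2) / 2) * ((2 * s + 1).choose ((2 * s + 1 - 2) / 2) : ℤ)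
        else 0 else 0) = 0 := by
      split_ifs <;> first | rfl | omega
    rw [e1, if_neg (by omega), if_pos (by omega), if_pos (by omega),
      show (2 * s + 1 - 1) / 2 = s by omega]
    simpa using h1

/-- Two terms survive in each parity. Vanishing would force C(m,t+1)/C(m,t) to be 3 for m = 2t+2, or
1/3 for m = 2t+3, whereas this ratio is (t+2)/(t+1), respectively (t+3)/(t+1). -/
theorem sum_alternating_choose_add_three_ne_zero (m : ℕ) :
    ∑ i ∈ Finset.range (m + 1), (-1) ^ i * (m.choose i : ℤ) * ((m + 3).choose i : ℤ) ≠ 0 := by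
  rw [sum_alternating_choose_add,
    show (1 - X ^ 2 : ℤ[X]) ^ m * (1 - X) ^ 3 = (1 - X ^ 2 : ℤ[X]) ^ m
      - C 3 * ((1 - X ^ 2 : ℤ[X]) ^ m * X ^ 1) + C 3 * ((1 - X ^ 2 : ℤ[X]) ^ m * X ^ 2)
      - (1 - X ^ 2 : ℤ[X]) ^ m * X ^ 3 by
      simp only [map_ofNat]; ring]
  simp only [coeff_add, coeff_sub, coeff_C_mul, coeff_mul_X_pow', coeff_one_sub_X_sq_pow]
  rcases Nat.even_or_odd' m with ⟨s, rfl | rfl⟩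
  · rcases s with _ | t
    · simp
    have e1 : (if 3 ≤ 2 * (t + 1) then if 2 ∣ 2 * (t + 1) - 3 then
        (-1 : ℤ) ^ ((2 * (t + 1) - 3) / 2) * ((2 * (t + 1)).choose ((2 * (t + 1) - 3) / 2) : ℤ)
        else 0 else 0) = 0 := by
      split_ifs <;> first | rfl | omega
    rw [e1, if_pos (by omega), if_pos (by omega), if_neg (by omega), if_pos (by omega),
      if_pos (by omega), show 2 * (t + 1) / 2 = t + 1 by omega,
      show (2 * (t + 1) - 2) / 2 = t by omega]
    have h := Nat.choose_succ_right_eq (2 * (t + 1)) t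
    have hp : 0 < (2 * (t + 1)).choose t := Nat.choose_pos (by omega)
    rw [show 2 * (t + 1) - t = t + 2 by omega] at h
    intro h0
    have h1 : (-1 : ℤ) ^ t *
        (3 * ((2 * (t + 1)).choose t : ℤ) - ((2 * (t + 1)).choose (t + 1) : ℤ)) = 0 := by
      rw [pow_succ] at h0; linear_combination h0
    rcases mul_eq_zero.mp h1 with h1 | h1
    · simp at h1
    · have h2 : (2 * (t + 1)).choose (t + 1) = (2 * (t + 1)).choose t * 3 := by omega
      rw [h2, mul_assoc] at h
      have := Nat.eq_of_mul_eq_mul_left hp h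
      omega
  · rcases s with _ | t
    · simp
    rw [if_neg (by omega), if_pos (by omega), if_pos (by omega), if_pos (by omega),
      if_neg (by omega), if_pos (by omega), if_pos (by omega),
      show (2 * (t + 1) + 1 - 1) / 2 = t + 1 by omega,
      show (2 * (t + 1) + 1 - 3) / 2 = t by omega]
    have h := Nat.choose_succ_right_eq (2 * (t + 1) + 1) t
    have hp : 0 < (2 * (t + 1) + 1).choose (t + 1) := Nat.choose_pos (by omega)
    rw [show 2 * (t + 1) + 1 - t = t + 3 by omega] at h
    intro h0
    have h1 : (-1 : ℤ) ^ t *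
        (3 * ((2 * (t + 1) + 1).choose (t + 1) : ℤ) - ((2 * (t + 1) + 1).choose t : ℤ)) = 0 := by
      rw [pow_succ] at h0; linear_combination h0
    rcases mul_eq_zero.mp h1 with h1 | h1
    · simp at h1
    · have h2 : (2 * (t + 1) + 1).choose t = (2 * (t + 1) + 1).choose (t + 1) * 3 := by omega
      rw [h2, mul_assoc] at h
      have := Nat.eq_of_mul_eq_mul_left hp h
      omega

/-- Multiply a vanishing sum by m!. For 1 ≤ i ≤ m, i! divides m! and i! C(n,i) is a falling
factorial divisible by n; so n divides the remaining term m!. -/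
theorem sum_alternating_choose_ne_zero_of_not_dvd (m n : ℕ) (h : ¬ n ∣ m !) :
    ∑ i ∈ Finset.range (m + 1), (-1) ^ i * (m.choose i : ℤ) * (n.choose i : ℤ) ≠ 0 := by
  intro h0
  apply h
  rw [Finset.sum_range_succ'] at h0
  have h1 : (m ! : ℤ) = -∑ i ∈ Finset.range m,
      (m ! : ℤ) * ((-1) ^ (i + 1) * (m.choose (i + 1) : ℤ) * (n.choose (i + 1) : ℤ)) := by
    rw [← Finset.mul_sum]
    simp only [pow_zero, Nat.choose_zero_right, Nat.cast_one, mul_one] at h0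
    linear_combination (m ! : ℤ) * h0
  rw [← Int.natCast_dvd_natCast, h1, dvd_neg]
  refine Finset.dvd_sum fun i hi => ?_
  obtain ⟨d, hd⟩ : (i + 1)! ∣ m ! := Nat.factorial_dvd_factorial (Finset.mem_range.mp hi)
  have h2 : (n : ℤ) ∣ ((i + 1)! : ℤ) * (n.choose (i + 1) : ℤ) := by
    rw [← Nat.cast_mul, ← Nat.descFactorial_eq_factorial_mul_choose]
    rcases n with _ | n
    · simp
    · rw [Nat.succ_descFactorial_succ]; simp
  rw [hd]
  push_cast
  exact (h2.mul_left (d * (-1) ^ (i + 1) * (m.choose (i + 1) : ℤ))).trans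
    (dvd_of_eq (by ring))

theorem sum_alternating_choose_ne_zero (r c : ℕ) (hr : 2 ≤ r)
    (h : (r = c ∧ Odd r) ∨ (r < c ∧ c ≤ r + 3) ∨ ¬ (c - 1 ∣ (r - 1)!)) :
    ∑ i ∈ Finset.range (r - 1 + 1),
      (-1) ^ i * ((r - 1).choose i : ℤ) * ((c - 1).choose i : ℤ) ≠ 0 := by
  rcases h with ⟨rfl, h⟩ | ⟨h1, h2⟩ | h
  · exact sum_alternating_choose_self_ne_zero _ (Nat.Odd.sub_odd h odd_one)
  · obtain h3 | h3 | h3 : c - 1 = r - 1 + 1 ∨ c - 1 = r - 1 + 2 ∨ c - 1 = r - 1 + 3 := by omega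
    · rw [h3]; exact sum_alternating_choose_add_one_ne_zero _
    · rw [h3]; exact sum_alternating_choose_add_two_ne_zero _
    · rw [h3]; exact sum_alternating_choose_add_three_ne_zero _
  · exact sum_alternating_choose_ne_zero_of_not_dvd _ _ h

/-! ### Real-rootedness through Gauss–Lucas. -/

theorem im_eq_zero_of_isRoot_derivative {f : ℂ[X]} (hf : ∀ z, f.eval z = 0 → z.im = 0)
    (hf' : derivative f ≠ 0) {z : ℂ} (hz : (derivative f).eval z = 0) : z.im = 0 := by
  have hdeg : 0 < f.degree := by
    by_contra hd
    rw [eq_C_of_degree_le_zero (not_lt.mp hd)] at hf'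
    simp at hf'
  have hz' : z ∈ (derivative f).rootSet ℂ := by
    rw [mem_rootSet]; exact ⟨hf', by simpa using hz⟩
  -- Gauss–Lucas puts the critical points in the convex hull of the roots, and the real line is
  -- convex.
  have hconv : Convex ℝ {z : ℂ | z.im = 0} := convex_hyperplane Complex.imLm.isLinear 0
  refine convexHull_min ?_ hconv (rootSet_derivative_subset_convexHull_rootSet hdeg hz')
  intro w hw
  rw [mem_rootSet] at hw
  exact hf w (by simpa using hw.2)

theorem im_eq_zero_of_isRoot_iterate_derivative {f : ℂ[X]} (hf : ∀ z, f.eval z = 0 → z.im = 0)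
    (k : ℕ) (hk : derivative^[k] f ≠ 0) {z : ℂ} (hz : (derivative^[k] f).eval z = 0) :
    z.im = 0 := by
  induction k generalizing z with
  | zero => exact hf z hz
  | succ k ih =>
    rw [Function.iterate_succ_apply'] at hk hz
    have hk' : derivative^[k] f ≠ 0 := fun h0 => hk (by rw [h0, derivative_zero])
    exact im_eq_zero_of_isRoot_derivative (fun w hw => ih hk' hw) hk hz

/-- By the Leibniz rule the derivative at w is m! ∑ C(m,k) C(n,k) w^k (w+1)^(n-k). Putting w =
z/(1-z), so that w+1 = 1/(1-z), turns w^k (w+1)^(n-k) into z^k/(1-z)^n. -/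
theorem eval_iterate_derivative_X_pow_mul {m n : ℕ} (hmn : m ≤ n) {z : ℂ} (hz : 1 - z ≠ 0) :
    (derivative^[m] (X ^ m * (X + C 1) ^ n : ℂ[X])).eval (z / (1 - z)) =
      m ! / (1 - z) ^ n * (chooseMulChoosePoly m n).eval₂ (Int.castRingHom ℂ) z := by
  have hw : z / (1 - z) + 1 = 1 / (1 - z) := by field_simp; ring
  rw [iterate_derivative_mul, chooseMulChoosePoly, eval_finsetSum, eval₂_finsetSum,
    Finset.mul_sum]
  refine Finset.sum_congr rfl fun k hk => ?_
  have hk' : k ≤ m := Nat.lt_succ_iff.mp (Finset.mem_range.mp hk)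
  rw [iterate_derivative_X_pow_eq_smul, iterate_derivative_X_add_pow,
    show m - (m - k) = k by omega]
  have h1 : m.descFactorial (m - k) * n.descFactorial k = m ! * n.choose k := by
    rw [Nat.descFactorial_eq_factorial_mul_choose n k, ← mul_assoc, mul_comm _ (k !)]
    congr 1
    have := Nat.factorial_mul_descFactorial (Nat.sub_le m k)
    rwa [show m - (m - k) = k by omega] at this
  have h2 : (m.descFactorial (m - k) : ℂ) * n.descFactorial k = m ! * n.choose k := by
    exact_mod_cast h1
  simp only [eval_mul, eval_smul, nsmul_eq_mul, eval_pow, eval_add, eval_X, eval_C, eval₂_mul,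
    eval₂_natCast, eval₂_pow, eval₂_X, smul_eq_mul, eval_natCast, hw, map_mul, map_natCast]
  obtain ⟨d, rfl⟩ := Nat.exists_eq_add_of_le (hk'.trans hmn)
  rw [Nat.add_sub_cancel_left, div_pow, div_pow, one_pow, pow_add]
  field_simp
  linear_combination (m.choose k : ℂ) * z ^ k * h2

theorem im_eq_zero_of_eval₂_chooseMulChoosePoly {m n : ℕ} (hmn : m ≤ n) {z : ℂ}
    (hz : (chooseMulChoosePoly m n).eval₂ (Int.castRingHom ℂ) z = 0) : z.im = 0 := by
  by_cases h1 : 1 - z = 0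
  · rw [← sub_eq_zero.mp h1, Complex.one_im]
  have hf : ∀ w, (X ^ m * (X + C 1) ^ n : ℂ[X]).eval w = 0 → w.im = 0 := by
    intro w hw
    rw [eval_mul, eval_pow, eval_pow, mul_eq_zero] at hw
    rcases hw with hw | hw
    · rw [eval_X] at hw; rw [eq_zero_of_pow_eq_zero hw, Complex.zero_im]
    · have := eq_zero_of_pow_eq_zero hw
      rw [eval_add, eval_X, eval_C] at this
      rw [eq_neg_of_add_eq_zero_left this]; simp
  have hne : derivative^[m] (X ^ m * (X + C 1) ^ n : ℂ[X]) ≠ 0 := by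
    intro h0
    have := eval_iterate_derivative_X_pow_mul hmn (z := 0) (by simp)
    rw [h0, eval₂_at_zero, coeff_chooseMulChoosePoly] at this
    simp only [eval_zero, Nat.choose_zero_right, sub_zero, one_pow, div_one, Nat.cast_one, mul_one,
      map_one, eq_comm (a := (0 : ℂ)), Nat.cast_eq_zero] at this
    exact Nat.factorial_ne_zero m this
  have hw : (z / (1 - z)).im = 0 := im_eq_zero_of_isRoot_iterate_derivative hf m hne
    (by rw [eval_iterate_derivative_X_pow_mul hmn h1, hz, mul_zero])
  have h2 : 1 + z / (1 - z) ≠ 0 := by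
    rw [show 1 + z / (1 - z) = 1 / (1 - z) by field_simp; ring]
    exact one_div_ne_zero h1
  -- Inverse of the substitution: z = w/(1+w) is real once w is.
  have h3 : z = z / (1 - z) / (1 + z / (1 - z)) := by
    have : 1 + z / (1 - z) = 1 / (1 - z) := by field_simp; ring
    rw [this]; field_simp
  obtain ⟨x, hx⟩ : ∃ x : ℝ, z / (1 - z) = x :=
    ⟨(z / (1 - z)).re, Complex.ext (by simp) (by simp [hw])⟩
  rw [h3, hx, ← Complex.ofReal_one, ← Complex.ofReal_add, ← Complex.ofReal_div, Complex.ofReal_im]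

theorem eval₂_chooseMulChoosePoly_ne_zero_of_isPrimitiveRoot {m n : ℕ} (hmn : m ≤ n)
    (h : (chooseMulChoosePoly m n).eval (-1) ≠ 0) {N : ℕ} (hN : 2 ≤ N) {ζ : ℂ}
    (hζ : IsPrimitiveRoot ζ N) :
    (chooseMulChoosePoly m n).eval₂ (Int.castRingHom ℂ) ζ ≠ 0 := by
  intro h0
  have him := im_eq_zero_of_eval₂_chooseMulChoosePoly hmn h0
  have hnorm : ‖ζ‖ = 1 := hζ.norm'_eq_one (by omega)
  obtain ⟨x, rfl⟩ : ∃ x : ℝ, ζ = x := ⟨ζ.re, Complex.ext (by simp) (by simp [him])⟩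
  rw [Complex.norm_real, Real.norm_eq_abs] at hnorm
  rcases eq_or_eq_neg_of_abs_eq hnorm with rfl | rfl
  · have := hζ.eq_orderOf
    simp at this
    omega
  · have h1 : ((-1 : ℝ) : ℂ) = Int.castRingHom ℂ (-1) := by simp
    rw [h1, eval₂_at_apply] at h0
    exact h (by simpa using h0)

end NarayanaType

/-! ### The rational form of the generating function of products of binomial coefficients. -/

section SegreSeries

open PowerSeries

/-- The generating function `∑ₖ (k+m choose m) (k+n choose n) tᵏ`. -/
noncomputable def chooseMulChooseSeries (m n : ℕ) : PowerSeries ℤ :=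
  PowerSeries.mk fun k => ((k + m).choose m : ℤ) * ((k + n).choose n : ℤ)

/-- Raising m by one amounts to applying t d/dt + (m+1), since (m+1) C(k+m+1,m+1) = (k+m+1)
C(k+m,m). -/
theorem succ_mul_chooseMulChooseSeries (m n : ℕ) :
    C ((m + 1 : ℕ) : ℤ) * chooseMulChooseSeries (m + 1) n =
      X * derivative ℤ (chooseMulChooseSeries m n) +
        C ((m + 1 : ℕ) : ℤ) * chooseMulChooseSeries m n := by
  ext k
  have h : ((m : ℤ) + 1) * ((k + (m + 1)).choose (m + 1) : ℤ) =
      (k + m + 1) * ((k + m).choose m : ℤ) := by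
    have := Nat.add_one_mul_choose_eq (k + m) m
    zify at this
    rw [← add_assoc, this]
    ring
  rcases k with _ | k
  · simp [chooseMulChooseSeries]
  · simp only [map_add, coeff_succ_X_mul, coeff_derivative, coeff_C_mul,
      chooseMulChooseSeries, coeff_mk]
    push_cast at h ⊢
    linear_combination ((k + 1 + n).choose n : ℤ) * h

/-- This is the effect of t d/dt + (m+1) on the numerator of a fraction with denominator
(1-t)^(m+n+1), so numerators and series obey the same recursion in m. -/
theorem succ_mul_chooseMulChoosePoly (m n : ℕ) :
    C ((m + 1 : ℕ) : ℤ) * (chooseMulChoosePoly (m + 1) n : PowerSeries ℤ) =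
      X * ((1 - X) * derivative ℤ (chooseMulChoosePoly m n : PowerSeries ℤ)) +
        C ((m + 1 : ℕ) : ℤ) * (chooseMulChoosePoly m n : PowerSeries ℤ) +
        C (n : ℤ) * (X * (chooseMulChoosePoly m n : PowerSeries ℤ)) := by
  ext i
  rcases i with _ | i
  · simp [coeff_chooseMulChoosePoly]
  have h1 : ((m + 1).choose (i + 1) : ℤ) = m.choose i + m.choose (i + 1) := by
    rw [Nat.choose_succ_succ]; push_cast; ring
  have h2 : (m.choose (i + 1) : ℤ) * (i + 1) = m.choose i * (m - i) := by
    have := Nat.choose_succ_right_eq m i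
    rcases le_or_gt i m with h | h
    · zify [h] at this; exact this
    · rw [Nat.choose_eq_zero_of_lt h, Nat.choose_eq_zero_of_lt (by omega)]; simp
  have h3 : (n.choose (i + 1) : ℤ) * (i + 1) = n.choose i * (n - i) := by
    have := Nat.choose_succ_right_eq n i
    rcases le_or_gt i n with h | h
    · zify [h] at this; exact this
    · rw [Nat.choose_eq_zero_of_lt h, Nat.choose_eq_zero_of_lt (by omega)]; simp
  have hX : coeff i ((1 - X) * derivative ℤ (chooseMulChoosePoly m n : PowerSeries ℤ)) =
      (m.choose (i + 1) : ℤ) * n.choose (i + 1) * (i + 1) - m.choose i * n.choose i * i := by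
    rw [sub_mul, one_mul, map_sub]
    rcases i with _ | i
    · simp [coeff_derivative, coeff_chooseMulChoosePoly]
    · simp [coeff_succ_X_mul, coeff_derivative, coeff_chooseMulChoosePoly]
  simp only [map_add, coeff_succ_X_mul, hX, coeff_C_mul, Polynomial.coeff_coe,
    coeff_chooseMulChoosePoly, h1]
  push_cast
  linear_combination (n.choose (i + 1) : ℤ) * (-h2) + (m.choose i : ℤ) * h3

theorem one_sub_X_pow_mul_chooseMulChooseSeries (m n : ℕ) :
    (1 - X) ^ (m + n + 1) * chooseMulChooseSeries m n =
      (chooseMulChoosePoly m n : PowerSeries ℤ) := by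
  induction m with
  | zero =>
    have h1 : chooseMulChooseSeries 0 n = (invOneSubPow ℤ (n + 1)).val := by
      rw [invOneSubPow_val_succ_eq_mk_add_choose]
      ext k
      simp [chooseMulChooseSeries, add_comm]
    have h2 : chooseMulChoosePoly 0 n = 1 := by simp [chooseMulChoosePoly]
    rw [h1, h2, zero_add, ← invOneSubPow_inv_eq_one_sub_pow, Polynomial.coe_one]
    exact (invOneSubPow ℤ (n + 1)).inv_val
  | succ m ih =>
    have hC : (C ((m + 1 : ℕ) : ℤ) : PowerSeries ℤ) ≠ 0 := by
      rw [Ne, map_eq_zero_iff _ C_injective]; positivity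
    have hd : derivative ℤ (chooseMulChoosePoly m n : PowerSeries ℤ) =
        (1 - X) ^ (m + n + 1) * derivative ℤ (chooseMulChooseSeries m n) -
        ((m + n + 1 : ℕ) : PowerSeries ℤ) * (1 - X) ^ (m + n) * chooseMulChooseSeries m n := by
      rw [← ih, Derivation.leibniz, derivative_pow, map_sub, derivative_one, derivative_X,
        smul_eq_mul, smul_eq_mul, Nat.add_sub_cancel]
      ring
    refine mul_left_cancel₀ hC ?_
    rw [succ_mul_chooseMulChoosePoly, hd, mul_left_comm, succ_mul_chooseMulChooseSeries, ← ih]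
    simp only [map_natCast]
    push_cast
    ring

end SegreSeries

/-! ### Graded quotients, and Hilbert series modulo regular linear forms. -/

section GradedQuotient

variable {k A : Type*} [Field k] [CommRing A] [Algebra k A]

theorem isInternal_quotientGrading (𝒜 : ℕ → Submodule k A) [GradedAlgebra 𝒜] {I : Ideal A}
    (hI : I.IsHomogeneous 𝒜) : DirectSum.IsInternal (quotientGrading 𝒜 I) := by
  classical
  refine DirectSum.isInternal_submodule_of_iSupIndep_of_iSup_eq_top ?_ ?_
  · rw [iSupIndep_iff_finsetSum_eq_zero_imp_eq_zero]
    intro s p hp hsum i hi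
    choose! a ha hap using hp
    have hmem : ∑ j ∈ s, a j ∈ I := by
      rw [← Ideal.Quotient.eq_zero_iff_mem, map_sum, ← hsum]
      exact Finset.sum_congr rfl fun j hj => hap j hj
    have hcomp := hI i hmem
    rw [DirectSum.decompose_sum, DFinsupp.finsetSum_apply, AddSubmonoidClass.coe_finsetSum,
      Finset.sum_eq_single i (fun j hj hji => DirectSum.decompose_of_mem_ne 𝒜 (ha j hj) hji)
        (fun h => absurd hi h), DirectSum.decompose_of_mem_same 𝒜 (ha i hi)] at hcomp
    rw [← hap i hi]
    exact Ideal.Quotient.eq_zero_iff_mem.mpr hcomp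
  · change ⨆ n, (𝒜 n).map (Ideal.Quotient.mkₐ k I).toLinearMap = ⊤
    rw [← Submodule.map_iSup,
      (DirectSum.Decomposition.isInternal 𝒜).submodule_iSup_eq_top, Submodule.map_top,
      LinearMap.range_eq_top]
    exact Ideal.Quotient.mk_surjective

/-- The quotient of a graded algebra by a homogeneous ideal is graded. -/
@[reducible]
noncomputable def quotientGradedAlgebra (𝒜 : ℕ → Submodule k A) [GradedAlgebra 𝒜] {I : Ideal A}
    (hI : I.IsHomogeneous 𝒜) : GradedAlgebra (quotientGrading 𝒜 I) :=
  { (isInternal_quotientGrading 𝒜 hI).chooseDecomposition with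
    one_mem := ⟨1, SetLike.GradedOne.one_mem, map_one (Ideal.Quotient.mkₐ k I)⟩
    mul_mem := by
      rintro i j _ _ ⟨a, ha, rfl⟩ ⟨b, hb, rfl⟩
      exact ⟨a * b, SetLike.GradedMul.mul_mem ha hb, map_mul (Ideal.Quotient.mkₐ k I) a b⟩ }

theorem isHomogeneous_ofList (𝒜 : ℕ → Submodule k A) [GradedAlgebra 𝒜] {l : List A} {n : ℕ}
    (hl : ∀ x ∈ l, x ∈ 𝒜 n) : (Ideal.ofList l).IsHomogeneous 𝒜 :=
  Ideal.homogeneous_span 𝒜 _ fun x hx => ⟨n, hl x hx⟩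

theorem Submodule.finrank_map_add_finrank_inf_ker {V W : Type*} [AddCommGroup V] [Module k V]
    [AddCommGroup W] [Module k W] (g : V →ₗ[k] W) (p : Submodule k V) [FiniteDimensional k p] :
    Module.finrank k (p.map g) + Module.finrank k (p ⊓ LinearMap.ker g : Submodule k V) =
      Module.finrank k p := by
  rw [← LinearMap.finrank_range_add_finrank_ker (g.domRestrict p), LinearMap.range_domRestrict,
    LinearMap.ker_domRestrict, LinearEquiv.finrank_eq (Submodule.equivMapOfInjective p.subtype
      p.injective_subtype (LinearMap.ker g |>.comap p.subtype)), Submodule.map_comap_subtype]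

theorem map_factor_quotientGrading (𝒜 : ℕ → Submodule k A) {I J : Ideal A} (h : I ≤ J) (n : ℕ) :
    (quotientGrading 𝒜 I n).map (Ideal.Quotient.factorₐ k h).toLinearMap =
      quotientGrading 𝒜 J n := by
  rw [quotientGrading, quotientGrading, ← Submodule.map_comp]
  rfl

/-- If a = j + b x has degree n+1, comparing components of that degree replaces b by its component
of degree n, and the component of j stays in the homogeneous ideal J. -/
theorem quotientGrading_inf_ker_factor_succ (𝒜 : ℕ → Submodule k A) [GradedAlgebra 𝒜]
    {J : Ideal A} (hJ : J.IsHomogeneous 𝒜) {x : A} (hx : x ∈ 𝒜 1) (n : ℕ) :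
    quotientGrading 𝒜 J (n + 1) ⊓ LinearMap.ker (Ideal.Quotient.factorₐ k
        (le_sup_left : J ≤ J ⊔ Ideal.span {x})).toLinearMap =
      (quotientGrading 𝒜 J n).map (LinearMap.mulLeft k (Ideal.Quotient.mk J x)) := by
  apply le_antisymm
  · rintro _ ⟨⟨a, ha, rfl⟩, hker⟩
    have hmem : a ∈ J ⊔ Ideal.span {x} := Ideal.Quotient.eq_zero_iff_mem.mp hker
    obtain ⟨j, hj, _, hy, rfl⟩ := Submodule.mem_sup.mp hmem
    obtain ⟨b, rfl⟩ := Ideal.mem_span_singleton'.mp hy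
    refine ⟨_, ⟨_, (DirectSum.decompose 𝒜 b n).2, rfl⟩, ?_⟩
    have h1 := DirectSum.decompose_of_mem_same 𝒜 ha
    rw [DirectSum.decompose_add, DirectSum.add_apply, Submodule.coe_add,
      DirectSum.coe_decompose_mul_add_of_right_mem 𝒜 hx] at h1
    have h2 : Ideal.Quotient.mk J (DirectSum.decompose 𝒜 j (n + 1) : A) = 0 :=
      Ideal.Quotient.eq_zero_iff_mem.mpr (hJ (n + 1) hj)
    change Ideal.Quotient.mk J x * Ideal.Quotient.mk J _ = Ideal.Quotient.mk J _
    rw [← h1, map_add, h2, zero_add, map_mul, mul_comm]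
  · rintro _ ⟨_, ⟨a, ha, rfl⟩, rfl⟩
    refine ⟨⟨a * x, SetLike.GradedMul.mul_mem ha hx, ?_⟩, ?_⟩
    · change Ideal.Quotient.mk J _ = Ideal.Quotient.mk J x * Ideal.Quotient.mk J _
      rw [map_mul, mul_comm]
    · change Ideal.Quotient.mk _ (x * a) = 0
      exact Ideal.Quotient.eq_zero_iff_mem.mpr
        (Ideal.mul_mem_right _ _ (Ideal.mem_sup_right (Ideal.mem_span_singleton_self x)))

theorem quotientGrading_inf_ker_factor_zero (𝒜 : ℕ → Submodule k A) [GradedAlgebra 𝒜]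
    {J : Ideal A} (hJ : J.IsHomogeneous 𝒜) {x : A} (hx : x ∈ 𝒜 1) :
    quotientGrading 𝒜 J 0 ⊓ LinearMap.ker (Ideal.Quotient.factorₐ k
        (le_sup_left : J ≤ J ⊔ Ideal.span {x})).toLinearMap = ⊥ := by
  rw [eq_bot_iff]
  rintro _ ⟨⟨a, ha, rfl⟩, hker⟩
  have hmem : a ∈ J ⊔ Ideal.span {x} := Ideal.Quotient.eq_zero_iff_mem.mp hker
  obtain ⟨j, hj, _, hy, rfl⟩ := Submodule.mem_sup.mp hmem
  obtain ⟨b, rfl⟩ := Ideal.mem_span_singleton'.mp hy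
  have h1 := DirectSum.decompose_of_mem_same 𝒜 ha
  rw [DirectSum.decompose_add, DirectSum.add_apply, Submodule.coe_add,
    DirectSum.coe_decompose_mul_of_right_mem_of_not_le 𝒜 hx (by omega), add_zero] at h1
  change Ideal.Quotient.mk J _ = 0
  rw [← h1]
  exact Ideal.Quotient.eq_zero_iff_mem.mpr (hJ 0 hj)

theorem finiteDimensional_quotientGrading (𝒜 : ℕ → Submodule k A) (I : Ideal A) (n : ℕ)
    [FiniteDimensional k (𝒜 n)] : FiniteDimensional k (quotientGrading 𝒜 I n) :=
  Module.Finite.map (𝒜 n) (Ideal.Quotient.mkₐ k I).toLinearMap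

/-- Dimension count in the exact sequence 0 → (A/J)(-1) → A/J → A/(J+(x)) → 0, whose first map is
multiplication by x. Degree 0 is separate because nothing maps into it. -/
theorem hilbertSeries_quotient_sup_span (𝒜 : ℕ → Submodule k A) [GradedAlgebra 𝒜]
    [∀ n, FiniteDimensional k (𝒜 n)] {J : Ideal A} (hJ : J.IsHomogeneous 𝒜) {x : A}
    (hx : x ∈ 𝒜 1) (hreg : ∀ a : A, x * a ∈ J → a ∈ J) :
    hilbertSeries (quotientGrading 𝒜 (J ⊔ Ideal.span {x})) =
      (1 - PowerSeries.X) * hilbertSeries (quotientGrading 𝒜 J) := by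
  have hinj : Function.Injective (LinearMap.mulLeft k (Ideal.Quotient.mk J x)) := by
    rw [← LinearMap.ker_eq_bot, eq_bot_iff]
    intro y hy
    obtain ⟨a, rfl⟩ := Ideal.Quotient.mk_surjective y
    have h0 : Ideal.Quotient.mk J x * Ideal.Quotient.mk J a = 0 := hy
    rw [← map_mul, Ideal.Quotient.eq_zero_iff_mem] at h0
    exact Ideal.Quotient.eq_zero_iff_mem.mpr (hreg a h0)
  have hfin := fun n => finiteDimensional_quotientGrading 𝒜 J n
  ext n
  rw [sub_mul, one_mul, map_sub]
  have h := Submodule.finrank_map_add_finrank_inf_ker (Ideal.Quotient.factorₐ k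
    (le_sup_left : J ≤ J ⊔ Ideal.span {x})).toLinearMap (quotientGrading 𝒜 J n)
  rw [map_factor_quotientGrading] at h
  rcases n with _ | n
  · rw [quotientGrading_inf_ker_factor_zero 𝒜 hJ hx, finrank_bot, add_zero] at h
    simp [hilbertSeries, h]
  · rw [quotientGrading_inf_ker_factor_succ 𝒜 hJ hx, ← LinearEquiv.finrank_eq
      (Submodule.equivMapOfInjective _ hinj (quotientGrading 𝒜 J n))] at h
    rw [PowerSeries.coeff_succ_X_mul]
    simp only [hilbertSeries, PowerSeries.coeff_mk, ← h]
    push_cast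
    ring

theorem hilbertSeries_quotient_bot (𝒜 : ℕ → Submodule k A) :
    hilbertSeries (quotientGrading 𝒜 (⊥ : Ideal A)) = hilbertSeries 𝒜 := by
  have hinj : Function.Injective (Ideal.Quotient.mkₐ k (⊥ : Ideal A)).toLinearMap := by
    intro a b hab
    exact sub_eq_zero.mp ((Submodule.mem_bot A).mp (Ideal.Quotient.eq.mp hab))
  ext n
  simp only [hilbertSeries, PowerSeries.coeff_mk]
  rw [LinearEquiv.finrank_eq (Submodule.equivMapOfInjective _ hinj (𝒜 n))]
  rfl

/-- Going modulo a weakly regular sequence of linear forms multiplies the Hilbert series by a power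
of `1 - t`. -/
theorem hilbertSeries_quotient_ofList (𝒜 : ℕ → Submodule k A) [GradedAlgebra 𝒜]
    [∀ n, FiniteDimensional k (𝒜 n)] (l : List A) (hl : ∀ x ∈ l, x ∈ 𝒜 1)
    (hreg : RingTheory.Sequence.IsWeaklyRegular A l) :
    hilbertSeries (quotientGrading 𝒜 (Ideal.ofList l)) =
      (1 - PowerSeries.X) ^ l.length * hilbertSeries 𝒜 := by
  suffices h : ∀ i ≤ l.length, hilbertSeries (quotientGrading 𝒜 (Ideal.ofList (l.take i))) =
      (1 - PowerSeries.X) ^ i * hilbertSeries 𝒜 by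
    have := h l.length le_rfl
    rwa [List.take_length] at this
  intro i hi
  induction i with
  | zero =>
    rw [List.take_zero, Ideal.ofList_nil, hilbertSeries_quotient_bot, pow_zero, one_mul]
  | succ i ih =>
    have hi' : i < l.length := hi
    rw [List.take_succ_eq_append_getElem hi', Ideal.ofList_append, Ideal.ofList_singleton,
      hilbertSeries_quotient_sup_span 𝒜 (isHomogeneous_ofList 𝒜 (n := 1)
        fun x hx => hl x (List.mem_of_mem_take hx)) (hl _ (List.getElem_mem hi')), ih hi'.le,
      pow_succ']
    · ring
    · intro a ha
      have hr := hreg.regular_mod_prev i hi'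
      -- Weak regularity is phrased on the module quotient by I • ⊤; `key` translates it to
      -- membership in I.
      have key : ∀ b : A, b ∈ Ideal.ofList (l.take i) ↔ Submodule.Quotient.mk
          (p := (Ideal.ofList (l.take i) • ⊤ : Submodule A A)) b = 0 := by
        intro b
        rw [Submodule.Quotient.mk_eq_zero, smul_eq_mul, Ideal.mul_top]
      rw [key] at ha ⊢
      refine hr ?_
      simp only [smul_zero]
      rw [← Submodule.Quotient.mk_smul]
      exact ha

end GradedQuotient

/-! ### Exact pairs of zero divisors in graded algebras. -/

section ExactPairs

variable {k S : Type*} [Field k] [CommRing S] [Algebra k S]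

theorem IsExactPair.symm {a b : S} (h : IsExactPair a b) : IsExactPair b a :=
  ⟨h.right_ne_zero, h.left_ne_zero, h.colon_right, h.colon_left⟩

theorem IsExactPair.mul_eq_zero_iff {a b x : S} (h : IsExactPair a b) :
    a * x = 0 ↔ ∃ y, b * y = x := by
  have : x ∈ (⊥ : Ideal S).colon {a} ↔ x ∈ Ideal.span {b} := by rw [h.colon_left]
  rw [Submodule.mem_colon_singleton, Ideal.mem_span_singleton', smul_eq_mul, Submodule.mem_bot,
    mul_comm] at this
  simpa only [mul_comm b] using this

theorem IsExactPair.mul_eq_zero {a b : S} (h : IsExactPair a b) : a * b = 0 :=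
  h.mul_eq_zero_iff.mpr ⟨1, mul_one b⟩

theorem IsExactPair.mul_isUnit_right {a b u : S} (h : IsExactPair a (b * u)) (hu : IsUnit u) :
    IsExactPair a b where
  left_ne_zero := h.left_ne_zero
  right_ne_zero := fun h0 => h.right_ne_zero (by rw [h0, zero_mul])
  colon_left := by rw [h.colon_left, Ideal.span_singleton_mul_right_unit hu]
  colon_right := by
    rw [← h.colon_right]
    ext x
    simp only [Submodule.mem_colon_singleton, smul_eq_mul, Submodule.mem_bot]
    rw [← mul_assoc, hu.mul_left_eq_zero]

/-- A nonzero element of degree 0 is a scalar, hence a unit, and a b = 0 would then kill b. -/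
theorem IsExactPair.pos_of_mem (𝒮 : ℕ → Submodule k S)
    (h0 : ∀ x ∈ 𝒮 0, ∃ c : k, algebraMap k S c = x) {a b : S}
    (h : IsExactPair a b) {p : ℕ} (ha : a ∈ 𝒮 p) : 0 < p := by
  refine Nat.pos_of_ne_zero fun hp => ?_
  rw [hp] at ha
  obtain ⟨c, rfl⟩ := h0 a ha
  have hc : c ≠ 0 := fun hc => h.left_ne_zero (by rw [hc, map_zero])
  exact h.right_ne_zero ((((IsUnit.mk0 c hc).map (algebraMap k S)).mul_right_eq_zero).mp
    h.mul_eq_zero)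

variable (𝒮 : ℕ → Submodule k S) [GradedAlgebra 𝒮]

theorem isNilpotent_of_mem_of_pos {N : ℕ} (hN : ∀ n, N ≤ n → 𝒮 n = ⊥) {i : ℕ} (hi : 0 < i) {x : S}
    (hx : x ∈ 𝒮 i) : IsNilpotent x := by
  refine ⟨N, ?_⟩
  have h := SetLike.pow_mem_graded N hx
  rw [hN (N • i) (by rw [smul_eq_mul]; exact Nat.le_mul_of_pos_right N hi)] at h
  exact h

/-- In a graded algebra with finitely many components and with `𝒮 0 = k`, an element is the sum of
a scalar and a nilpotent element. -/
theorem isNilpotent_sub_decompose_zero {N : ℕ} (hN : ∀ n, N ≤ n → 𝒮 n = ⊥) (x : S) :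
    IsNilpotent (x - DirectSum.decompose 𝒮 x 0) := by
  classical
  rw [← mem_nilradical]
  have h := DirectSum.sum_support_decompose 𝒮 x
  have h2 : x - DirectSum.decompose 𝒮 x 0 =
      ∑ i ∈ (DirectSum.decompose 𝒮 x).support.erase 0, (DirectSum.decompose 𝒮 x i : S) := by
    by_cases h0 : 0 ∈ (DirectSum.decompose 𝒮 x).support
    · rw [sub_eq_iff_eq_add']
      exact h.symm.trans (Finset.add_sum_erase _ (fun i => (DirectSum.decompose 𝒮 x i : S)) h0).symm
    · rw [Finset.erase_eq_of_notMem h0, h, DFinsupp.notMem_support_iff.mp h0, ZeroMemClass.coe_zero,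
        sub_zero]
  rw [h2]
  refine Ideal.sum_mem _ fun i hi => ?_
  exact mem_nilradical.mpr (isNilpotent_of_mem_of_pos 𝒮 hN
    (Nat.pos_of_ne_zero (Finset.ne_of_mem_erase hi)) (DirectSum.decompose 𝒮 x i).2)

theorem isLocalRing_of_graded [Nontrivial S] {N : ℕ} (hN : ∀ n, N ≤ n → 𝒮 n = ⊥)
    (h0 : ∀ x ∈ 𝒮 0, ∃ c : k, algebraMap k S c = x) : IsLocalRing S := by
  refine IsLocalRing.of_isUnit_or_isUnit_one_sub_self fun x => ?_
  obtain ⟨c, hc⟩ := h0 _ (DirectSum.decompose 𝒮 x 0).2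
  have hnil := isNilpotent_sub_decompose_zero 𝒮 hN x
  rw [← hc] at hnil
  by_cases h : c = 0
  · right
    rw [h, map_zero, sub_zero] at hnil
    exact hnil.isUnit_one_sub
  · left
    have hu : IsUnit (algebraMap k S c) := (IsUnit.mk0 c h).map _
    have := hnil.isUnit_add_left_of_commute hu (Commute.all _ _)
    rwa [add_sub_cancel] at this

/-- The annihilator generator of a homogeneous exact zero divisor may be taken homogeneous. -/
theorem IsExactPair.exists_homogeneous_right [IsLocalRing S] {a b : S} (h : IsExactPair a b)
    {p : ℕ} (ha : a ∈ 𝒮 p) : ∃ q, ∃ b' ∈ 𝒮 q, IsExactPair a b' := by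
  classical
  -- Since a is homogeneous, a b = 0 annihilates each component of b, so each component is a
  -- multiple b t_i.
  have hmem : ∀ i, ∃ y, b * y = (DirectSum.decompose 𝒮 b i : S) := by
    intro i
    rw [← h.mul_eq_zero_iff, ← DirectSum.coe_decompose_mul_add_of_left_mem 𝒮 ha, h.mul_eq_zero,
      DirectSum.decompose_zero]
    rfl
  choose t ht using hmem
  have hsum : b * ∑ i ∈ (DirectSum.decompose 𝒮 b).support, t i = b := by
    rw [Finset.mul_sum]
    simp only [ht]
    exact DirectSum.sum_support_decompose 𝒮 b
  -- If no t_i were a unit, their sum would lie in the maximal ideal, and b (1 - ∑ t_i) = 0 would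
  -- give b = 0. A component b t_i with t_i a unit generates the same ideal as b.
  obtain ⟨i, hi⟩ : ∃ i, IsUnit (t i) := by
    by_contra! hcon
    have h1 : ∑ i ∈ (DirectSum.decompose 𝒮 b).support, t i ∈ IsLocalRing.maximalIdeal S :=
      Ideal.sum_mem _ fun i _ => (IsLocalRing.mem_maximalIdeal _).mpr (hcon i)
    have h2 : IsUnit (1 - ∑ i ∈ (DirectSum.decompose 𝒮 b).support, t i) := by
      rcases IsLocalRing.isUnit_or_isUnit_one_sub_self
        (∑ i ∈ (DirectSum.decompose 𝒮 b).support, t i) with h3 | h3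
      · exact absurd h3 ((IsLocalRing.mem_maximalIdeal _).mp h1)
      · exact h3
    refine h.right_ne_zero (h2.mul_left_eq_zero.mp ?_)
    rw [mul_sub, hsum, mul_one, sub_self]
  refine ⟨i, _, (DirectSum.decompose 𝒮 b i).2, ?_⟩
  obtain ⟨u, hu⟩ := hi
  refine IsExactPair.mul_isUnit_right (u := ((u⁻¹ : Sˣ) : S)) ?_ u⁻¹.isUnit
  rwa [← ht i, ← hu, mul_assoc, Units.mul_inv, mul_one]

theorem IsExactPair.inf_ker_mulLeft_add {a b : S} (h : IsExactPair a b) {q : ℕ} (hb : b ∈ 𝒮 q)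
    (n : ℕ) : 𝒮 (n + q) ⊓ LinearMap.ker (LinearMap.mulLeft k a) =
      (𝒮 n).map (LinearMap.mulLeft k b) := by
  apply le_antisymm
  · rintro x ⟨hx, hker⟩
    obtain ⟨y, rfl⟩ := h.mul_eq_zero_iff.mp (show a * x = 0 from hker)
    refine ⟨_, (DirectSum.decompose 𝒮 y n).2, ?_⟩
    rw [LinearMap.mulLeft_apply, ← DirectSum.coe_decompose_mul_add_of_left_mem 𝒮 hb, add_comm q n,
      DirectSum.decompose_of_mem_same 𝒮 hx]
  · rintro _ ⟨y, hy, rfl⟩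
    refine ⟨?_, ?_⟩
    · rw [LinearMap.mulLeft_apply, add_comm n q]
      exact SetLike.GradedMul.mul_mem hb hy
    · exact h.mul_eq_zero_iff.mpr ⟨y, rfl⟩

theorem IsExactPair.inf_ker_mulLeft_of_lt {a b : S} (h : IsExactPair a b) {q : ℕ} (hb : b ∈ 𝒮 q)
    {n : ℕ} (hn : n < q) : 𝒮 n ⊓ LinearMap.ker (LinearMap.mulLeft k a) = ⊥ := by
  rw [eq_bot_iff]
  rintro x ⟨hx, hker⟩
  obtain ⟨y, rfl⟩ := h.mul_eq_zero_iff.mp (show a * x = 0 from hker)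
  rw [Submodule.mem_bot, ← DirectSum.decompose_of_mem_same 𝒮 hx,
    DirectSum.coe_decompose_mul_of_left_mem_of_not_le 𝒮 hb (by omega)]

/-- Rank-nullity for multiplication by a, whose kernel is bS. Images are indexed by the degree of
the source, so the only shift is by q = deg b, in the kernel term. -/
theorem IsExactPair.hilbertSeries_eq [∀ n, FiniteDimensional k (𝒮 n)] {a b : S}
    (h : IsExactPair a b) {q : ℕ} (hb : b ∈ 𝒮 q) :
    hilbertSeries 𝒮 = hilbertSeries (fun n => (𝒮 n).map (LinearMap.mulLeft k a)) +
      PowerSeries.X ^ q * hilbertSeries (fun n => (𝒮 n).map (LinearMap.mulLeft k b)) := by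
  ext n
  have h1 := Submodule.finrank_map_add_finrank_inf_ker (LinearMap.mulLeft k a) (𝒮 n)
  rw [map_add, PowerSeries.coeff_X_pow_mul']
  simp only [hilbertSeries, PowerSeries.coeff_mk]
  split_ifs with hn
  · obtain ⟨m, rfl⟩ := Nat.exists_eq_add_of_le' hn
    rw [h.inf_ker_mulLeft_add 𝒮 hb] at h1
    rw [Nat.add_sub_cancel, ← h1, Nat.cast_add]
  · rw [h.inf_ker_mulLeft_of_lt 𝒮 hb (not_le.mp hn), finrank_bot] at h1
    rw [← h1, add_zero, add_zero]

theorem exists_polynomial_eq_hilbertSeries {V : Type*} [AddCommGroup V] [Module k V]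
    (𝒱 : ℕ → Submodule k V) {N : ℕ} (hN : ∀ n, N ≤ n → 𝒱 n = ⊥) :
    ∃ P : Polynomial ℤ, (P : PowerSeries ℤ) = hilbertSeries 𝒱 := by
  refine ⟨PowerSeries.trunc N (hilbertSeries 𝒱), ?_⟩
  ext n
  rw [Polynomial.coeff_coe, PowerSeries.coeff_trunc]
  split_ifs with h
  · rfl
  · rw [hilbertSeries, PowerSeries.coeff_mk, hN n (not_lt.mp h), finrank_bot, Nat.cast_zero]

/-- If a finite-dimensional connected graded algebra has a homogeneous exact zero divisor, its
Hilbert series vanishes at all primitive `n`-th roots of unity for some `n ≥ 2`. -/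
theorem exists_eval₂_primitiveRoot_eq_zero_of_isExactZeroDivisor
    [∀ n, FiniteDimensional k (𝒮 n)] {N : ℕ} (hN : ∀ n, N ≤ n → 𝒮 n = ⊥)
    (h0 : ∀ x ∈ 𝒮 0, ∃ c : k, algebraMap k S c = x) {H : Polynomial ℤ}
    (hH : (H : PowerSeries ℤ) = hilbertSeries 𝒮) {a : S} (ha : SetLike.IsHomogeneousElem 𝒮 a)
    (hex : IsExactZeroDivisor a) :
    ∃ n, 2 ≤ n ∧ ∀ ζ : ℂ, IsPrimitiveRoot ζ n → H.eval₂ (Int.castRingHom ℂ) ζ = 0 := by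
  obtain ⟨p, ha⟩ := ha
  obtain ⟨b₀, hab₀⟩ := hex
  have : Nontrivial S := ⟨a, 0, hab₀.left_ne_zero⟩
  have : IsLocalRing S := isLocalRing_of_graded 𝒮 hN h0
  obtain ⟨q, b, hb, hab⟩ := hab₀.exists_homogeneous_right 𝒮 ha
  have hp := hab.pos_of_mem 𝒮 h0 ha
  have hq := hab.symm.pos_of_mem 𝒮 h0 hb
  refine ⟨p + q, by omega, fun ζ hζ => ?_⟩
  obtain ⟨P, hP⟩ := exists_polynomial_eq_hilbertSeries
    (fun n => (𝒮 n).map (LinearMap.mulLeft k a)) (N := N) fun n hn => by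
      rw [hN n hn, Submodule.map_bot]
  have h1 := hab.hilbertSeries_eq 𝒮 hb
  have h2 := hab.symm.hilbertSeries_eq 𝒮 ha
  rw [← hH, ← hP] at h1 h2
  -- Eliminate the series of the image of b between the two decompositions of H.
  have h3 : ((H * (1 - Polynomial.X ^ q) : Polynomial ℤ) : PowerSeries ℤ) =
      (P * (1 - Polynomial.X ^ (p + q)) : Polynomial ℤ) := by
    push_cast
    linear_combination h1 - PowerSeries.X ^ q * h2
  have h4 := congrArg (Polynomial.eval₂ (Int.castRingHom ℂ) ζ) (Polynomial.coe_injective ℤ h3)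
  simp only [Polynomial.eval₂_mul, Polynomial.eval₂_sub, Polynomial.eval₂_one,
    Polynomial.eval₂_pow, Polynomial.eval₂_X, hζ.pow_eq_one, sub_self, mul_zero] at h4
  refine (mul_eq_zero.mp h4).resolve_right fun h5 => ?_
  -- The factor 1 - ζ^q is nonzero because 0 < q < p + q.
  exact hζ.pow_ne_one_of_pos_of_lt hq.ne' (by omega) (sub_eq_zero.mp h5).symm

end ExactPairs

/-! ### The ring of 2 × 2 minors as a Segre product: a monomial basis in each degree. -/

section Segre

theorem Multiset.exists_map_fst_eq_map_snd_eq {α β : Type*} (a : Multiset α) (b : Multiset β)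
    (h : a.card = b.card) : ∃ s : Multiset (α × β), s.map Prod.fst = a ∧ s.map Prod.snd = b := by
  induction a using Quotient.inductionOn with | h la => ?_
  induction b using Quotient.inductionOn with | h lb => ?_
  have h' : la.length = lb.length := h
  refine ⟨(la.zip lb : List (α × β)), ?_, ?_⟩
  · rw [Multiset.map_coe, List.map_fst_zip h'.le]; rfl
  · rw [Multiset.map_coe, List.map_snd_zip h'.ge]; rfl

/-- If `f` satisfies the rank-one relations, then the product of `f` over a multiset of pairs depends
only on the two margins of the multiset. -/
theorem Multiset.prod_map_eq_of_margins_eq {α β M : Type*} [CommMonoid M] (f : α × β → M)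
    (hf : ∀ i i' j j', f (i, j) * f (i', j') = f (i, j') * f (i', j)) (s t : Multiset (α × β))
    (h1 : s.map Prod.fst = t.map Prod.fst) (h2 : s.map Prod.snd = t.map Prod.snd) :
    (s.map f).prod = (t.map f).prod := by
  classical
  induction t using Multiset.induction_on generalizing s with
  | empty =>
    rw [Multiset.map_zero, Multiset.map_eq_zero] at h1
    rw [h1]
  | cons x t ih =>
    obtain ⟨i, j⟩ := x
    obtain ⟨⟨i₁, j'⟩, hx, rfl⟩ : ∃ x ∈ s, x.1 = i :=
      Multiset.mem_map.mp (by rw [h1, Multiset.map_cons]; exact Multiset.mem_cons_self _ _)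
    obtain ⟨⟨i', j₁⟩, hy, rfl⟩ : ∃ x ∈ s, x.2 = j :=
      Multiset.mem_map.mp (by rw [h2, Multiset.map_cons]; exact Multiset.mem_cons_self _ _)
    obtain ⟨u, rfl⟩ := Multiset.exists_cons_of_mem hx
    rcases Multiset.mem_cons.mp hy with hxy | hy
    · obtain ⟨rfl, rfl⟩ := Prod.mk.inj hxy
      simp only [Multiset.map_cons, Multiset.cons_inj_right] at h1 h2
      simp only [Multiset.map_cons, Multiset.prod_cons, ih u h1 h2]
    -- Row i₁ and column j₁ occur in two different pairs of s; a rank-one exchange of their columns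
    -- creates (i₁, j₁), which cancels against the head of t.
    · obtain ⟨u, rfl⟩ := Multiset.exists_cons_of_mem hy
      simp only [Multiset.map_cons, Multiset.cons_inj_right] at h1
      simp only [Multiset.map_cons] at h2
      rw [Multiset.cons_swap, Multiset.cons_inj_right] at h2
      have h3 := ih ((i', j') ::ₘ u) (by simpa using h1) (by simpa using h2)
      rw [Multiset.map_cons, Multiset.prod_cons] at h3
      simp only [Multiset.map_cons, Multiset.prod_cons, ← h3]
      rw [← mul_assoc, hf i₁ i' j' j₁, mul_assoc]

theorem MvPolynomial.prod_map_X_eq_monomial {k σ : Type*} [CommSemiring k] [DecidableEq σ]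
    (s : Multiset σ) :
    (s.map (X : σ → MvPolynomial σ k)).prod = monomial (Multiset.toFinsupp s) 1 := by
  induction s using Multiset.induction_on with
  | empty => simp
  | cons a s ih =>
    rw [Multiset.map_cons, Multiset.prod_cons, ih, ← Multiset.singleton_add, map_add,
      Multiset.toFinsupp_singleton, X, monomial_mul, mul_one]

theorem Multiset.isHomogeneous_prod_map_X {k σ : Type*} [CommSemiring k] (s : Multiset σ) :
    ((s.map (MvPolynomial.X : σ → MvPolynomial σ k)).prod).IsHomogeneous s.card := by
  induction s using Multiset.induction_on with
  | empty => simpa using MvPolynomial.isHomogeneous_one σ k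
  | cons a s ih =>
    rw [Multiset.map_cons, Multiset.prod_cons, Multiset.card_cons, add_comm]
    exact (MvPolynomial.isHomogeneous_X k a).mul ih

attribute [local instance] MvPolynomial.gradedAlgebra

variable (k : Type*) [Field k] (r c : ℕ)

/-- The class of the variable `x_{ij}` in the determinantal ring. -/
noncomputable def segreVar (x : Fin r × Fin c) : DeterminantalRing k r c 2 :=
  Ideal.Quotient.mk _ (MvPolynomial.X x)

theorem isHomogeneous_minorsIdeal_two :
    (minorsIdeal 2 (Matrix.mvPolynomialX (Fin r) (Fin c) k)).IsHomogeneous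
      (MvPolynomial.homogeneousSubmodule (Fin r × Fin c) k) := by
  refine Ideal.homogeneous_span _ _ ?_
  rintro _ ⟨f, g, rfl⟩
  refine ⟨2, ?_⟩
  rw [Matrix.det_fin_two]
  exact ((MvPolynomial.isHomogeneous_X k _).mul (MvPolynomial.isHomogeneous_X k _)).sub
    ((MvPolynomial.isHomogeneous_X k _).mul (MvPolynomial.isHomogeneous_X k _))

theorem segreVar_mul_of_lt {i i' : Fin r} {j j' : Fin c} (hi : i < i') (hj : j < j') :
    segreVar k r c (i, j) * segreVar k r c (i', j') =
      segreVar k r c (i, j') * segreVar k r c (i', j) := by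
  rw [segreVar, segreVar, segreVar, segreVar, ← map_mul, ← map_mul, Ideal.Quotient.eq]
  refine Ideal.subset_span ⟨OrderEmbedding.ofStrictMono ![i, i'] ?_,
    OrderEmbedding.ofStrictMono ![j, j'] ?_, ?_⟩
  · rw [Fin.strictMono_iff_lt_succ]; intro x; fin_cases x; simpa using hi
  · rw [Fin.strictMono_iff_lt_succ]; intro x; fin_cases x; simpa using hj
  · rw [Matrix.det_fin_two]; simp

theorem segreVar_mul (i i' : Fin r) (j j' : Fin c) :
    segreVar k r c (i, j) * segreVar k r c (i', j') =
      segreVar k r c (i, j') * segreVar k r c (i', j) := by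
  rcases lt_trichotomy i i' with hi | rfl | hi
  · rcases lt_trichotomy j j' with hj | rfl | hj
    · exact segreVar_mul_of_lt k r c hi hj
    · rfl
    · exact (segreVar_mul_of_lt k r c hi hj).symm
  · exact mul_comm _ _
  · rw [mul_comm, mul_comm (segreVar k r c (i, j'))]
    rcases lt_trichotomy j j' with hj | rfl | hj
    · exact (segreVar_mul_of_lt k r c hi hj).symm
    · rfl
    · exact segreVar_mul_of_lt k r c hi hj

variable {k r c}

/-- The algebra map sending `x_{ij}` to `f i * g j`. -/
noncomputable def segreHom {B : Type*} [CommRing B] [Algebra k B] (f : Fin r → B) (g : Fin c → B) :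
    DeterminantalRing k r c 2 →ₐ[k] B :=
  Ideal.Quotient.liftₐ _ (MvPolynomial.aeval fun x : Fin r × Fin c => f x.1 * g x.2) <| by
    intro a ha
    have hle : minorsIdeal 2 (Matrix.mvPolynomialX (Fin r) (Fin c) k) ≤
        RingHom.ker (MvPolynomial.aeval (R := k) fun x : Fin r × Fin c => f x.1 * g x.2) := by
      refine Ideal.span_le.mpr ?_
      rintro _ ⟨u, v, rfl⟩
      rw [SetLike.mem_coe, RingHom.mem_ker, Matrix.det_fin_two]
      simp only [Matrix.submatrix_apply, Matrix.mvPolynomialX_apply, map_sub, map_mul,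
        MvPolynomial.aeval_X]
      ring
    exact hle ha

theorem segreHom_segreVar {B : Type*} [CommRing B] [Algebra k B] (f : Fin r → B) (g : Fin c → B)
    (x : Fin r × Fin c) : segreHom (k := k) f g (segreVar k r c x) = f x.1 * g x.2 :=
  MvPolynomial.aeval_X (R := k) (fun x : Fin r × Fin c => f x.1 * g x.2) x

theorem comp_segreHom {B B' : Type*} [CommRing B] [Algebra k B] [CommRing B'] [Algebra k B']
    (τ : B →ₐ[k] B') (f : Fin r → B) (g : Fin c → B) :
    τ.comp (segreHom (k := k) f g) = segreHom (fun i => τ (f i)) (fun j => τ (g j)) := by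
  refine Ideal.Quotient.algHom_ext _ (MvPolynomial.algHom_ext fun x => ?_)
  change τ (segreHom f g (segreVar k r c x)) =
    segreHom (fun i => τ (f i)) (fun j => τ (g j)) (segreVar k r c x)
  rw [segreHom_segreVar, segreHom_segreVar, map_mul]

/-- A multiset of pairs with the given margins. -/
noncomputable def withMargins {n : ℕ} (p : Sym (Fin r) n × Sym (Fin c) n) :
    Multiset (Fin r × Fin c) :=
  (Multiset.exists_map_fst_eq_map_snd_eq (p.1 : Multiset (Fin r)) (p.2 : Multiset (Fin c))
    (by rw [Sym.card_coe, Sym.card_coe])).choose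

theorem map_fst_withMargins {n : ℕ} (p : Sym (Fin r) n × Sym (Fin c) n) :
    (withMargins p).map Prod.fst = p.1 :=
  (Multiset.exists_map_fst_eq_map_snd_eq (p.1 : Multiset (Fin r)) (p.2 : Multiset (Fin c))
    (by rw [Sym.card_coe, Sym.card_coe])).choose_spec.1

theorem map_snd_withMargins {n : ℕ} (p : Sym (Fin r) n × Sym (Fin c) n) :
    (withMargins p).map Prod.snd = p.2 :=
  (Multiset.exists_map_fst_eq_map_snd_eq (p.1 : Multiset (Fin r)) (p.2 : Multiset (Fin c))
    (by rw [Sym.card_coe, Sym.card_coe])).choose_spec.2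

variable (k) in
/-- The monomial of the determinantal ring with the given row and column margins. -/
noncomputable def segreMonomial {n : ℕ} (p : Sym (Fin r) n × Sym (Fin c) n) :
    DeterminantalRing k r c 2 :=
  ((withMargins p).map (segreVar k r c)).prod

theorem prod_map_segreVar (s : Multiset (Fin r × Fin c)) :
    (s.map (segreVar k r c)).prod = Ideal.Quotient.mk _ ((s.map MvPolynomial.X).prod) := by
  rw [map_multiset_prod, Multiset.map_map]
  rfl

theorem prod_map_segreVar_eq_segreMonomial {n : ℕ} (s : Multiset (Fin r × Fin c))
    (p : Sym (Fin r) n × Sym (Fin c) n) (h1 : s.map Prod.fst = p.1) (h2 : s.map Prod.snd = p.2) :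
    (s.map (segreVar k r c)).prod = segreMonomial k p :=
  Multiset.prod_map_eq_of_margins_eq _ (segreVar_mul k r c) _ _
    (h1.trans (map_fst_withMargins p).symm) (h2.trans (map_snd_withMargins p).symm)

theorem segreHom_segreMonomial {n : ℕ} (p : Sym (Fin r) n × Sym (Fin c) n) :
    segreHom (fun i => MvPolynomial.X (Sum.inl i)) (fun j => MvPolynomial.X (Sum.inr j))
      (segreMonomial k p) = (MvPolynomial.monomial (Multiset.toFinsupp
        ((p.1 : Multiset (Fin r)).map Sum.inl + (p.2 : Multiset (Fin c)).map Sum.inr)) 1 :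
          MvPolynomial (Fin r ⊕ Fin c) k) := by
  rw [segreMonomial, map_multiset_prod, Multiset.map_map]
  simp only [Function.comp_def, segreHom_segreVar]
  rw [Multiset.prod_map_mul, ← MvPolynomial.prod_map_X_eq_monomial, Multiset.map_add,
    Multiset.prod_add, Multiset.map_map, Multiset.map_map, ← map_fst_withMargins p,
    ← map_snd_withMargins p, Multiset.map_map, Multiset.map_map]
  rfl

/-- Under x_ij ↦ y_i z_j these elements become distinct monomials, because the exponent vector
records both margins. -/
theorem linearIndependent_segreMonomial (n : ℕ) :
    LinearIndependent k
      (segreMonomial k : Sym (Fin r) n × Sym (Fin c) n → DeterminantalRing k r c 2) := by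
  refine LinearIndependent.of_comp (segreHom (fun i => MvPolynomial.X (Sum.inl i))
    (fun j => MvPolynomial.X (Sum.inr j)) :
      _ →ₐ[k] MvPolynomial (Fin r ⊕ Fin c) k).toLinearMap ?_
  have hinj : Function.Injective fun p : Sym (Fin r) n × Sym (Fin c) n =>
      Multiset.toFinsupp
        ((p.1 : Multiset (Fin r)).map Sum.inl + (p.2 : Multiset (Fin c)).map Sum.inr) := by
    rintro ⟨a, b⟩ ⟨a', b'⟩ h
    have h := Multiset.toFinsupp.injective h
    have hl := congrArg (Multiset.filterMap Sum.getLeft?) h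
    have hr := congrArg (Multiset.filterMap Sum.getRight?) h
    have hz : ∀ {α β : Type} (s : Multiset α), s.filterMap (fun _ => (none : Option β)) = 0 := by
      intro α β s
      induction s using Multiset.induction_on with
      | empty => rfl
      | cons a s ih => rw [Multiset.filterMap_cons_none _ _ rfl, ih]
    simp only [Multiset.filterMap_add, Multiset.filterMap_map, Function.comp_def,
      Sum.getLeft?_inl, Sum.getLeft?_inr, Sum.getRight?_inl, Sum.getRight?_inr,
      Multiset.filterMap_some, hz, add_zero, zero_add, Sym.coe_inj] at hl hr
    rw [hl, hr]
  have h := (MvPolynomial.basisMonomials (Fin r ⊕ Fin c) k).linearIndependent.comp _ hinj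
  rw [MvPolynomial.coe_basisMonomials] at h
  have he : ⇑(segreHom (fun i => MvPolynomial.X (Sum.inl i)) (fun j => MvPolynomial.X (Sum.inr j)) :
      _ →ₐ[k] MvPolynomial (Fin r ⊕ Fin c) k).toLinearMap ∘ (segreMonomial k (n := n)) =
      (fun d => MvPolynomial.monomial d 1) ∘ fun p : Sym (Fin r) n × Sym (Fin c) n =>
      Multiset.toFinsupp
        ((p.1 : Multiset (Fin r)).map Sum.inl + (p.2 : Multiset (Fin c)).map Sum.inr) :=
    funext fun p => segreHom_segreMonomial p
  rw [he]
  exact h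

theorem grading_eq_span_range_segreMonomial (n : ℕ) :
    DeterminantalRing.grading k r c 2 n = Submodule.span k (Set.range
      (segreMonomial k : Sym (Fin r) n × Sym (Fin c) n → DeterminantalRing k r c 2)) := by
  apply le_antisymm
  · rintro _ ⟨p, hp, rfl⟩
    have hp' : p.IsHomogeneous n := hp
    rw [p.as_sum, map_sum]
    refine Submodule.sum_mem _ fun d hd => ?_
    have hd' : (Finsupp.toMultiset d).card = n := by
      rw [Finsupp.card_toMultiset]
      have := hp' (MvPolynomial.mem_support_iff.mp hd)
      simpa [Finsupp.weight_apply, Finsupp.sum] using this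
    have : MvPolynomial.monomial d (p.coeff d) =
        p.coeff d • ((Finsupp.toMultiset d).map MvPolynomial.X).prod := by
      rw [MvPolynomial.prod_map_X_eq_monomial, Finsupp.toMultiset_toFinsupp,
        MvPolynomial.smul_monomial, smul_eq_mul, mul_one]
    rw [this, map_smul]
    refine Submodule.smul_mem _ _ (Submodule.subset_span
      ⟨(⟨(Finsupp.toMultiset d).map Prod.fst, by rw [Multiset.card_map, hd']⟩,
        ⟨(Finsupp.toMultiset d).map Prod.snd, by rw [Multiset.card_map, hd']⟩), ?_⟩)
    exact (prod_map_segreVar_eq_segreMonomial _ _ rfl rfl).symm.trans (prod_map_segreVar _)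
  · rw [Submodule.span_le]
    rintro _ ⟨p, rfl⟩
    refine ⟨_, ?_, (prod_map_segreVar _).symm⟩
    have hcard := congrArg Multiset.card (map_fst_withMargins p)
    rw [Multiset.card_map, Sym.card_coe] at hcard
    have := Multiset.isHomogeneous_prod_map_X (k := k) (withMargins p)
    rwa [hcard] at this

instance finiteDimensional_grading (n : ℕ) :
    FiniteDimensional k (DeterminantalRing.grading k r c 2 n) := by
  rw [grading_eq_span_range_segreMonomial]
  exact FiniteDimensional.span_of_finite k (Set.finite_range _)

/-- The basis in degree i is indexed by pairs of multisets of size i, counted by stars and bars. -/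
theorem hilbertSeries_determinantalRing_grading (m n : ℕ) :
    hilbertSeries (DeterminantalRing.grading k (m + 1) (n + 1) 2) = chooseMulChooseSeries m n := by
  ext i
  rw [hilbertSeries, chooseMulChooseSeries, PowerSeries.coeff_mk, PowerSeries.coeff_mk,
    grading_eq_span_range_segreMonomial,
    finrank_span_eq_card (linearIndependent_segreMonomial i), Fintype.card_prod,
    Sym.card_sym_eq_choose, Sym.card_sym_eq_choose, Fintype.card_fin, Fintype.card_fin,
    show m + 1 + i - 1 = i + m by omega, show n + 1 + i - 1 = i + n by omega,
    Nat.choose_symm_add, Nat.choose_symm_add, Nat.cast_mul]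

/-! ### A chain of primes bounding the Krull dimension from below. -/

variable (k r c) in
/-- The map sending `x_{ij}` to `y_i z_j` if `i < a` and `j < b`, and to `0` otherwise. -/
noncomputable def truncatedSegreHom (a b : ℕ) :
    DeterminantalRing k r c 2 →ₐ[k] MvPolynomial (Fin r ⊕ Fin c) k :=
  segreHom (fun i => if (i : ℕ) < a then MvPolynomial.X (Sum.inl i) else 0)
    (fun j => if (j : ℕ) < b then MvPolynomial.X (Sum.inr j) else 0)

theorem truncatedSegreHom_segreVar (a b : ℕ) (x : Fin r × Fin c) :
    truncatedSegreHom k r c a b (segreVar k r c x) =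
      (if (x.1 : ℕ) < a then MvPolynomial.X (Sum.inl x.1) else 0) *
        (if (x.2 : ℕ) < b then MvPolynomial.X (Sum.inr x.2) else 0) :=
  segreHom_segreVar _ _ x

theorem exists_comp_truncatedSegreHom {a b a' b' : ℕ} (ha : a' ≤ a) (hb : b' ≤ b) :
    ∃ τ : MvPolynomial (Fin r ⊕ Fin c) k →ₐ[k] MvPolynomial (Fin r ⊕ Fin c) k,
      τ.comp (truncatedSegreHom k r c a b) = truncatedSegreHom k r c a' b' := by
  refine ⟨MvPolynomial.aeval (Sum.elim
    (fun i => if (i : ℕ) < a' then MvPolynomial.X (Sum.inl i) else 0)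
    (fun j => if (j : ℕ) < b' then MvPolynomial.X (Sum.inr j) else 0)), ?_⟩
  rw [truncatedSegreHom, comp_segreHom, truncatedSegreHom]
  congr 1
  · funext i
    by_cases h : (i : ℕ) < a
    · rw [if_pos h, MvPolynomial.aeval_X, Sum.elim_inl]
    · rw [if_neg h, map_zero, if_neg (by omega)]
  · funext j
    by_cases h : (j : ℕ) < b
    · rw [if_pos h, MvPolynomial.aeval_X, Sum.elim_inr]
    · rw [if_neg h, map_zero, if_neg (by omega)]

/-- Killing more variables factors through killing fewer, giving the inclusion. It is strict because
x_(a-1,0) or x_(0,b-1) is killed only by the smaller truncation. -/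
theorem ker_truncatedSegreHom_lt {a b a' b' : ℕ} (ha : 0 < a) (har : a ≤ r) (hb : 0 < b)
    (hbc : b ≤ c) (haa : a' ≤ a) (hbb : b' ≤ b) (hlt : a' < a ∨ b' < b) :
    RingHom.ker (truncatedSegreHom k r c a b) < RingHom.ker (truncatedSegreHom k r c a' b') := by
  refine lt_of_le_of_ne ?_ fun heq => ?_
  · obtain ⟨τ, hτ⟩ := exists_comp_truncatedSegreHom (k := k) (r := r) (c := c) haa hbb
    intro y hy
    rw [RingHom.mem_ker] at hy ⊢
    rw [← hτ, AlgHom.comp_apply, hy, map_zero]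
  · have key : ∀ x : Fin r × Fin c, (x.1 : ℕ) < a → (x.2 : ℕ) < b →
        (a' ≤ x.1 ∨ b' ≤ x.2) → False := by
      intro x h1 h2 h3
      have hmem : segreVar k r c x ∈ RingHom.ker (truncatedSegreHom k r c a' b') := by
        rw [RingHom.mem_ker, truncatedSegreHom_segreVar]
        rcases h3 with h3 | h3
        · rw [if_neg (not_lt.mpr h3), zero_mul]
        · rw [if_neg (not_lt.mpr h3), mul_zero]
      rw [← heq, RingHom.mem_ker, truncatedSegreHom_segreVar, if_pos h1, if_pos h2] at hmem
      exact mul_ne_zero (MvPolynomial.X_ne_zero _) (MvPolynomial.X_ne_zero _) hmem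
    rcases hlt with h | h
    · exact key (⟨a - 1, by omega⟩, ⟨0, by omega⟩) (Nat.sub_one_lt_of_lt ha) hb
        (Or.inl (Nat.le_sub_one_of_lt h))
    · exact key (⟨0, by omega⟩, ⟨b - 1, by omega⟩) ha (Nat.sub_one_lt_of_lt hb)
        (Or.inr (Nat.le_sub_one_of_lt h))

theorem le_ringKrullDim_determinantalRing (m n : ℕ) :
    ((m + n + 1 : ℕ) : WithBot ℕ∞) ≤ ringKrullDim (DeterminantalRing k (m + 1) (n + 1) 2) := by
  -- The truncation starts at (m+1, n+1). The first m steps remove rows down to one, the next n+1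
  -- remove all columns: m+n+1 strict inclusions. The kernels are prime since the target is a
  -- domain.
  let P : ℕ → PrimeSpectrum (DeterminantalRing k (m + 1) (n + 1) 2) := fun s =>
    ⟨RingHom.ker (truncatedSegreHom k (m + 1) (n + 1) (max 1 (m + 1 - s))
      (min (n + 1) (m + n + 1 - s))), RingHom.ker_isPrime _⟩
  have hmono : StrictMono fun s : Fin (m + n + 1 + 1) => P s := by
    rw [Fin.strictMono_iff_lt_succ]
    intro s
    have hs := s.2
    refine ker_truncatedSegreHom_lt ?_ ?_ ?_ ?_ ?_ ?_ ?_ <;>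
      simp only [Fin.val_castSucc, Fin.val_succ] <;> omega
  exact Order.LTSeries.length_le_krullDim (LTSeries.mk (m + n + 1) _ hmono)

end Segre

-- The Hilbert series of the Artinian reduction, and the conclusion.

attribute [local instance] MvPolynomial.gradedAlgebra in
/-- The grading of the determinantal ring of `2 × 2` minors. -/
@[reducible]
noncomputable def DeterminantalRing.gradedAlgebraTwo (k : Type*) [Field k] (r c : ℕ) :
    GradedAlgebra (DeterminantalRing.grading k r c 2) :=
  quotientGradedAlgebra _ (isHomogeneous_minorsIdeal_two k r c)

theorem exists_algebraMap_eq_of_mem_quotientGrading_zero {k A : Type*} [Field k] [CommRing A]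
    [Algebra k A] {𝒜 : ℕ → Submodule k A} (h : ∀ x ∈ 𝒜 0, ∃ c : k, algebraMap k A c = x)
    (I : Ideal A) : ∀ x ∈ quotientGrading 𝒜 I 0, ∃ c : k, algebraMap k (A ⧸ I) c = x := by
  rintro _ ⟨a, ha, rfl⟩
  obtain ⟨c, rfl⟩ := h a ha
  exact ⟨c, rfl⟩

theorem eval_one_pos_of_coe_eq_hilbertSeries {k V : Type*} [Field k] [AddCommGroup V] [Module k V]
    {𝒱 : ℕ → Submodule k V} {H : Polynomial ℤ} (hH : (H : PowerSeries ℤ) = hilbertSeries 𝒱)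
    (h0 : 0 < H.coeff 0) : 0 < H.eval 1 := by
  have hnn : ∀ n, 0 ≤ H.coeff n := by
    intro n
    rw [← Polynomial.coeff_coe, hH, hilbertSeries, PowerSeries.coeff_mk]
    exact Nat.cast_nonneg _
  rw [Polynomial.eval_eq_sum_range]
  simp only [one_pow, mul_one]
  exact Finset.sum_pos' (fun n _ => hnn n) ⟨0, by simp, h0⟩

/-- The Hilbert series of an Artinian reduction of the determinantal ring of `2 × 2` minors. -/
theorem hilbertSeries_artinianReduction {k : Type*} [Field k] (m n : ℕ)
    (ℓ : List (DeterminantalRing k (m + 1) (n + 1) 2))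
    (hℓ : IsArtinianReductionSeq (DeterminantalRing.grading k (m + 1) (n + 1) 2) ℓ) :
    (chooseMulChoosePoly m n : PowerSeries ℤ) = hilbertSeries
      (quotientGrading (DeterminantalRing.grading k (m + 1) (n + 1) 2) (Ideal.ofList ℓ)) := by
  let _ := DeterminantalRing.gradedAlgebraTwo k (m + 1) (n + 1)
  have hS := hilbertSeries_quotient_ofList (DeterminantalRing.grading k (m + 1) (n + 1) 2) ℓ
    hℓ.linear hℓ.regular.toIsWeaklyRegular
  rw [hilbertSeries_determinantalRing_grading] at hS
  have hd : m + n + 1 ≤ ℓ.length := by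
    have := le_ringKrullDim_determinantalRing (k := k) m n
    rw [hℓ.length_eq] at this
    exact_mod_cast this
  obtain ⟨e, he⟩ := Nat.exists_eq_add_of_le' hd
  rw [he, pow_add, mul_assoc, one_sub_X_pow_mul_chooseMulChooseSeries] at hS
  rcases e with _ | e
  · rw [hS, pow_zero, one_mul]
  -- The upper bound on the dimension comes from positivity: a longer sequence would make 1 - t
  -- divide the Hilbert polynomial, which would vanish at 1 although its coefficients are
  -- nonnegative with constant term 1.
  · have hH : (((1 - Polynomial.X) ^ (e + 1) * chooseMulChoosePoly m n : Polynomial ℤ) :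
        PowerSeries ℤ) = hilbertSeries
      (quotientGrading (DeterminantalRing.grading k (m + 1) (n + 1) 2) (Ideal.ofList ℓ)) := by
      rw [hS]; push_cast; rfl
    have hpos := eval_one_pos_of_coe_eq_hilbertSeries hH (by
      rw [Polynomial.mul_coeff_zero, coeff_chooseMulChoosePoly, coeff_one_sub_X_pow_int]
      simp)
    simp at hpos

theorem mainTheorem5 {k : Type*} [Field k] (r c : ℕ) (hr : 2 ≤ r) (hrc : r ≤ c)
    (h : (r = c ∧ Odd r) ∨ (r < c ∧ c ≤ r + 3) ∨ ¬ (c - 1 ∣ (r - 1)!))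
    (ℓ : List (DeterminantalRing k r c 2))
    (hℓ : IsArtinianReductionSeq (DeterminantalRing.grading k r c 2) ℓ) :
    (¬ ∃ θ : DeterminantalRing k r c 2 ⧸ Ideal.ofList ℓ,
        SetLike.IsHomogeneousElem
          (quotientGrading (DeterminantalRing.grading k r c 2) (Ideal.ofList ℓ)) θ ∧
        IsExactZeroDivisor θ) ∧
    (∃ H : Polynomial ℤ,
        (H : PowerSeries ℤ) =
          hilbertSeries (quotientGrading (DeterminantalRing.grading k r c 2) (Ideal.ofList ℓ)) ∧
        H.eval (-1) =
          ∑ i ∈ Finset.range r, (-1) ^ i * ((r - 1).choose i : ℤ) * ((c - 1).choose i : ℤ) ∧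
        H.eval (-1) ≠ 0) := by
  obtain ⟨m, rfl⟩ := Nat.exists_eq_add_of_le' (show 1 ≤ r by omega)
  obtain ⟨n, rfl⟩ := Nat.exists_eq_add_of_le' (show 1 ≤ c by omega)
  have hS := hilbertSeries_artinianReduction m n ℓ hℓ
  have hne := sum_alternating_choose_ne_zero (m + 1) (n + 1) hr h
  have heval := eval_neg_one_chooseMulChoosePoly m n
  simp only [Nat.add_sub_cancel] at hne ⊢
  rw [← heval] at hne
  refine ⟨?_, _, hS, heval, hne⟩
  rintro ⟨θ, hθ, hex⟩
  let _ := DeterminantalRing.gradedAlgebraTwo k (m + 1) (n + 1)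
  let _ := quotientGradedAlgebra (DeterminantalRing.grading k (m + 1) (n + 1) 2)
    (isHomogeneous_ofList (DeterminantalRing.grading k (m + 1) (n + 1) 2) hℓ.linear)
  have hfin := finiteDimensional_quotientGrading (DeterminantalRing.grading k (m + 1) (n + 1) 2)
    (Ideal.ofList ℓ)
  -- The Hilbert series has degree at most m, and a finite-dimensional component of rank 0 is zero;
  -- this provides the nilpotence used to make S local.
  have htop : ∀ i, m + 1 ≤ i → quotientGrading (DeterminantalRing.grading k (m + 1) (n + 1) 2)
      (Ideal.ofList ℓ) i = ⊥ := by
    intro i hi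
    have hc := congrArg (PowerSeries.coeff i) hS
    rw [Polynomial.coeff_coe, coeff_chooseMulChoosePoly, Nat.choose_eq_zero_of_lt hi, hilbertSeries,
      PowerSeries.coeff_mk, Nat.cast_zero, zero_mul, eq_comm, Nat.cast_eq_zero] at hc
    exact Submodule.finrank_eq_zero.mp hc
  have hzero : ∀ x ∈ MvPolynomial.homogeneousSubmodule (Fin (m + 1) × Fin (n + 1)) k 0,
      ∃ a : k, algebraMap k (MvPolynomial (Fin (m + 1) × Fin (n + 1)) k) a = x := by
    intro x hx
    rw [MvPolynomial.homogeneousSubmodule_zero] at hx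
    exact Submodule.mem_one.mp hx
  obtain ⟨N, hN, hroot⟩ := exists_eval₂_primitiveRoot_eq_zero_of_isExactZeroDivisor _ htop
    (exists_algebraMap_eq_of_mem_quotientGrading_zero
      (exists_algebraMap_eq_of_mem_quotientGrading_zero hzero _) _) hS hθ hex
  have hζ := Complex.isPrimitiveRoot_exp N (by omega)
  exact eval₂_chooseMulChoosePoly_ne_zero_of_isPrimitiveRoot (by omega) hne hN hζ (hroot _ hζ)
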